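/- Let $\mathcal S,\mathcal A,\mathcal E$ be finite sets (states, actions, events) with $\mathcal A\neq\emptyset$, let $d\in\mathbb N$, and let a Lexicographic Markov Decision Process (LMDP) be given by - for each $(s,a)\in\mathcal S\times\mathcal A$, a probability distribution $\mathbb P(\cdot\mid s,a)$ on $\mathcal S\times\mathcal E$ (next state and event); - rewards $r:\mathcal E\to\mathbb R^d$; - reward multipliers $\Gamma:\mathcal E\to \mathrm{LTP}_d\cup\{\mathbf 0\}$, where $\mathrm{LTP}_d$ is the set of real lower triangular $d\times d$ matrices with positive diagonal entries. Assume that $\Gamma_{i,i}(e)<1$ for all $e\in\mathcal E$ and $1\le i\le d$. Vectors of $\mathbb R^d$ are compared lexicographically, the first entry having the highest priority. A policy $\pi$ may be randomized and may depend on the whole history of states, actions and events; it is stationary deterministic if it is given by a function $f:\mathcal S\to\mathcal A$, the action $f(s)$ being taken whenever the current state is $s$. The return of a trajectory $s_0,a_0,e_0,s_1,a_1,e_1,\dots$ is $$G=\sum_{t=0}^\infty \Gamma(e_0)\Gamma(e_1)\cdots\Gamma(e_{t-1})\,r(e_t),$$ and $V^\pi(s)=\mathbb E_\pi[G\mid s_0=s]$,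 $Q^\pi(s,a)=\mathbb E_\pi[G\mid s_0=s,a_0=a]$. Then the series defining $G$ converges absolutely for every sequence of events, and $G$ is integrable under every policy, from every $s$ and from every $(s,a)$. The lexicographic maximum $Q^\star(s,a)=\operatorname{lexmax}_\pi Q^\pi(s,a)$ over all policies exists for all $(s,a)$, and: 1. There exists a stationary deterministic policy $\pi$ that is uniformly optimal, i.e. $Q^\pi=Q^\star$; it can be chosen such that, moreover, $V^{\pi'}(s)\le_{\mathrm{lex}}V^\pi(s)$ for all policies $\pi'$ and all starting states $s$. 2. Every stationary deterministic policy $\pi:\mathcal S\to\mathcal A$ with $\pi(s)\in\operatorname{lexargmax}_{a}Q^\star(s,a)$ for all $s\in\mathcal S$ has both of these properties. -/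

import Mathlib

open MeasureTheory ProbabilityTheory

/-- `LTP d`: real lower triangular `d × d` matrices with positive diagonal entries. -/
def LTP (d : ℕ) : Set (Matrix (Fin d) (Fin d) ℝ) :=
  {G | (∀ i j, i < j → G i j = 0) ∧ ∀ i, 0 < G i i}

/-- A lexicographic Markov decision process with state set `S`, action set `A`, event set `E`
and `d`-dimensional rewards. -/
structure LMDP (S A E : Type*) (d : ℕ) where
  /-- joint law of the next state and the emitted event, given the current state and action -/
  trans : S → A → PMF (S × E)
  /-- reward vector of an event -/
  reward : E → Fin d → ℝ
  /-- matrix reward multiplier of an event (zero for terminal events) -/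
  mult : E → Matrix (Fin d) (Fin d) ℝ
  mult_mem : ∀ e, mult e ∈ LTP d ∪ {0}

/-- One step of the interaction: the action taken, the event observed, the state reached. -/
@[ext]
structure Step (S A E : Type*) where
  action : A
  event : E
  next : S

namespace Step

variable {S A E : Type*}

/-- Steps carry the discrete σ-algebra. -/
instance : MeasurableSpace (Step S A E) := ⊤

instance : DiscreteMeasurableSpace (Step S A E) := ⟨fun _ => trivial⟩

instance [Finite S] [Finite A] [Finite E] : Finite (Step S A E) :=
  Finite.of_injective (fun x : Step S A E => (x.action, x.event, x.next)) (by
    intro x y h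
    simp only [Prod.mk.injEq] at h
    exact Step.ext h.1 h.2.1 h.2.2)

end Step

/-- The current state after the initial state `s₀` and the steps `h 0, …, h (n - 1)`. -/
def currentState {S A E : Type*} (s₀ : S) : {n : ℕ} → (Fin n → Step S A E) → S
  | 0, _ => s₀
  | n + 1, h => (h (Fin.last n)).next

/-- A general policy, history-dependent and randomized: at each time `n` it maps the initial
state and the first `n` steps to a distribution over actions. -/
def Policy (S A E : Type*) := (n : ℕ) → S → (Fin n → Step S A E) → PMF A

/-- The stationary deterministic policy that takes action `f s` whenever the state is `s`. -/
noncomputable def Policy.stationary {S A : Type*} (E : Type*) (f : S → A) : Policy S A E :=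
  fun _ s₀ h => PMF.pure (f (currentState s₀ h))

/-- The lexicographic argmax over `a` of the vectors `q a`. -/
def lexArgmax {A : Type*} {d : ℕ} (q : A → Fin d → ℝ) : Set A :=
  {a | ∀ b, toLex (q b) ≤ toLex (q a)}

namespace LMDP

variable {S A E : Type*} {d : ℕ} (M : LMDP S A E d)

/-- Every diagonal entry of every reward multiplier is less than one. -/
def DiagonalDiscount : Prop := ∀ e i, M.mult e i i < 1

/-- The product `Γ(e₀) Γ(e₁) ⋯ Γ(eₜ₋₁)`. -/
def discount (e : ℕ → E) : ℕ → Matrix (Fin d) (Fin d) ℝ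
  | 0 => 1
  | t + 1 => discount e t * M.mult (e t)

/-- The contribution `Γ(e₀) ⋯ Γ(eₜ₋₁) r(eₜ)` of time `t` to the return. -/
def discountedReward (e : ℕ → E) (t : ℕ) : Fin d → ℝ :=
  (M.discount e t).mulVec (M.reward (e t))

/-- The return `r(e₀) + Γ(e₀) r(e₁) + Γ(e₀) Γ(e₁) r(e₂) + ⋯` of a sequence of events. -/
noncomputable def eventReturn (e : ℕ → E) : Fin d → ℝ := ∑' t, M.discountedReward e t

/-- The return of a trajectory. -/
noncomputable def trajReturn (ω : ℕ → Step S A E) : Fin d → ℝ :=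
  M.eventReturn fun t => (ω t).event

/-- The law of the step from state `s` when taking action `a`. -/
noncomputable def stepLaw (s : S) (a : A) : PMF (Step S A E) :=
  (M.trans s a).map fun x => ⟨a, x.2, x.1⟩

/-- The law of the next step after a history `h`, when the action is drawn from `π`. -/
noncomputable def policyStep (π : Policy S A E) (s₀ : S) {n : ℕ} (h : Fin n → Step S A E) :
    PMF (Step S A E) :=
  (π n s₀ h).bind fun a => M.stepLaw (currentState s₀ h) a

variable [Finite S] [Finite A] [Finite E]

/-- The transition kernel of the interaction of `π` with the process, from the steps
`0, …, n` to step `n + 1`. -/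
noncomputable def stepKernel (π : Policy S A E) (s₀ : S) (n : ℕ) :
    Kernel ((i : Finset.Iic n) → Step S A E) (Step S A E) :=
  Kernel.ofFunOfCountable fun x =>
    (M.policyStep π s₀ fun i : Fin (n + 1) =>
      x ⟨i, Finset.mem_Iic.2 (Nat.lt_succ_iff.1 i.2)⟩).toMeasure

instance (π : Policy S A E) (s₀ : S) (n : ℕ) : IsMarkovKernel (M.stepKernel π s₀ n) :=
  ⟨fun _ => PMF.toMeasure.isProbabilityMeasure _⟩

/-- The law of the infinite trajectory from state `s₀`, when step `0` has law `μ` and the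
later actions are drawn from `π`. -/
noncomputable def trajLaw (π : Policy S A E) (s₀ : S) (μ : PMF (Step S A E)) :
    Measure (ℕ → Step S A E) :=
  Kernel.trajMeasure (X := fun _ => Step S A E) μ.toMeasure (M.stepKernel π s₀)

/-- The trajectory law given `s₀ = s` and `a₀ = a`, following `π` thereafter. -/
noncomputable def lawQ (π : Policy S A E) (s : S) (a : A) : Measure (ℕ → Step S A E) :=
  M.trajLaw π s (M.stepLaw s a)

/-- The trajectory law given `s₀ = s`, following `π`. -/
noncomputable def lawV (π : Policy S A E) (s : S) : Measure (ℕ → Step S A E) :=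
  M.trajLaw π s (M.policyStep π s Fin.elim0)

/-- The `Q`-value function of a policy. -/
noncomputable def qValue (π : Policy S A E) (s : S) (a : A) : Fin d → ℝ :=
  ∫ ω, M.trajReturn ω ∂M.lawQ π s a

/-- The value function of a policy. -/
noncomputable def value (π : Policy S A E) (s : S) : Fin d → ℝ :=
  ∫ ω, M.trajReturn ω ∂M.lawV π s

/-- `q` is the optimal `Q`-value function: `q s a` is the lexicographic maximum, over all
policies `π`, of the `Q`-values of `π` at `(s, a)`. -/
def IsOptimalQ (q : S → A → Fin d → ℝ) : Prop :=
  ∀ s a, IsGreatest (Set.range fun π : Policy S A E => toLex (M.qValue π s a)) (toLex (q s a))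

/-- `π` is optimal, among all policies, from every starting state. -/
def IsOptimalFromEveryState (π : Policy S A E) : Prop :=
  ∀ (π' : Policy S A E) (s : S), toLex (M.value π' s) ≤ toLex (M.value π s)

/-- `π` is uniformly optimal: its `Q`-value function is the optimal `Q`-value function. -/
def IsUniformlyOptimal (π : Policy S A E) : Prop := M.IsOptimalQ (M.qValue π)

end LMDP

/-!
Conjugation by `diag(1, K, K², …)` leaves the diagonal of a lower triangular matrix unchanged and,
as `K → ∞`, sends its other entries to zero. Hence the finitely many reward multipliers are
simultaneously conjugate to strict contractions, and discounted rewards decay geometrically.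

Reward multipliers preserve the lexicographic order, and so do expectations. Therefore, if `V`
dominates its one-step lookahead at every state and action, the expected `n`-step return with
terminal value `V` decreases with `n` under every policy. It converges to the expected return, and
although the lexicographic order is not closed, a sequence that is monotone for it is bounded by
its limit: the first coordinate is monotone, and if its limit equals its initial value, then it is
constant, so that the second coordinate is monotone, and so on. Thus a solution of the lexicographic
Bellman equation bounds the values of all policies, and a greedy policy attains these bounds.

Such a solution is the value function of a stationary policy that is maximal among the finitely many
stationary policies, for otherwise its greedy policy would improve on it. This uses that the value
function of a stationary policy solves its evaluation equation, a square linear system whose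
homogeneous version describes a process without rewards and so has no nonzero solution.
-/

open Filter Topology Matrix

section LexOrder

variable {ι α : Type*} [LinearOrder ι]

theorem toLex_le_toLex_of_forall_prefix [WellFoundedLT ι] [LinearOrder α] {x y : ι → α}
    (P : ι → Prop) (hP : ∀ i, (∀ j < i, P j) → x i = y i → P i)
    (hle : ∀ i, (∀ j < i, P j) → x i ≤ y i) : toLex x ≤ toLex y := by
  by_contra h
  obtain ⟨i, heq, hlt⟩ := not_le.1 h
  have hprefix : ∀ j < i, P j := by
    intro j
    induction j using WellFoundedLT.induction with
    | _ j ih => exact fun hj => hP j (fun k hk => ih k hk (hk.trans hj)) (heq j hj).symm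
  exact (hle i hprefix).not_gt hlt

theorem toLex_le_toLex_of_tendsto [WellFoundedLT ι] [LinearOrder α] [TopologicalSpace α]
    [OrderClosedTopology α] {β : Type*} [Preorder β] [IsDirectedOrder β] {u : β → ι → α}
    {l : ι → α} (hu : Monotone fun n => toLex (u n)) (hl : Tendsto u atTop (𝓝 l)) (b : β) :
    toLex (u b) ≤ toLex l := by
  have : Nonempty β := ⟨b⟩
  have coord_le : ∀ i, (∀ j < i, ∀ n ≥ b, u n j = u b j) →
      ∀ n ≥ b, u b i ≤ u n i ∧ u n i ≤ l i := by
    intro i hconst n hbn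
    have mono : ∀ m k, b ≤ m → m ≤ k → u m i ≤ u k i := fun m k hbm hmk =>
      Pi.apply_le_of_toLex (hu hmk) fun j hj =>
        (hconst j hj m hbm).trans (hconst j hj k (hbm.trans hmk)).symm
    exact ⟨mono b n le_rfl hbn, ge_of_tendsto (tendsto_pi_nhds.1 hl i)
      ((eventually_ge_atTop n).mono fun k hk => mono n k hbn hk)⟩
  refine toLex_le_toLex_of_forall_prefix (fun i => ∀ n ≥ b, u n i = u b i)
    (fun i hconst heq n hn => ?_) fun i hconst => (coord_le i hconst b le_rfl).2
  obtain ⟨hge, hle⟩ := coord_le i hconst n hn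
  exact le_antisymm (hle.trans heq.ge) hge

theorem toLex_integral_mono_ae [Fintype ι] {Ω : Type*} [MeasurableSpace Ω] {μ : Measure Ω}
    {X Y : Ω → ι → ℝ} (hX : Integrable X μ) (hY : Integrable Y μ)
    (hXY : ∀ᵐ ω ∂μ, toLex (X ω) ≤ toLex (Y ω)) :
    toLex (∫ ω, X ω ∂μ) ≤ toLex (∫ ω, Y ω ∂μ) := by
  have ae_le : ∀ i, (∀ j < i, ∀ᵐ ω ∂μ, X ω j = Y ω j) → ∀ᵐ ω ∂μ, X ω i ≤ Y ω i := by
    intro i hprefix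
    filter_upwards [(Set.toFinite (Set.Iio i)).eventually_all.2 hprefix, hXY] with ω heq hle
    exact Pi.apply_le_of_toLex hle heq
  have apply_integral : ∀ {Z : Ω → ι → ℝ}, Integrable Z μ →
      ∀ i, (∫ ω, Z ω ∂μ) i = ∫ ω, Z ω i ∂μ := fun hZ => eval_integral fun i => hZ.eval i
  refine toLex_le_toLex_of_forall_prefix (fun i => ∀ᵐ ω ∂μ, X ω i = Y ω i)
    (fun i hprefix heq => ?_) fun i hprefix => ?_
  · rw [apply_integral hX, apply_integral hY] at heq
    exact (integral_eq_iff_of_ae_le (hX.eval i) (hY.eval i) (ae_le i hprefix)).1 heq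
  · rw [apply_integral hX, apply_integral hY]
    exact integral_mono_ae (hX.eval i) (hY.eval i) (ae_le i hprefix)

theorem toLex_mulVec_mono {d : ℕ} {G : Matrix (Fin d) (Fin d) ℝ} (hG : G ∈ LTP d ∪ {0})
    {x y : Fin d → ℝ} (hxy : toLex x ≤ toLex y) : toLex (G *ᵥ x) ≤ toLex (G *ᵥ y) := by
  rcases hG with ⟨hlower, hdiag⟩ | rfl
  · have mulVec_sub_apply : ∀ i, (∀ j < i, x j = y j) →
        (G *ᵥ y) i - (G *ᵥ x) i = G i i * (y i - x i) := by
      intro i hprefix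
      rw [← Pi.sub_apply, ← mulVec_sub]
      refine Finset.sum_eq_single i (fun j _ hj => ?_) fun h => absurd (Finset.mem_univ i) h
      rcases hj.lt_or_gt with hlt | hgt
      · rw [Pi.sub_apply, hprefix j hlt, sub_self, mul_zero]
      · exact mul_eq_zero_of_left (hlower i j hgt) _
    refine toLex_le_toLex_of_forall_prefix (fun i => x i = y i) (fun i hprefix heq => ?_)
      fun i hprefix => ?_
    · have hmul : G i i * (y i - x i) = 0 := by rw [← mulVec_sub_apply i hprefix, heq, sub_self]
      exact (sub_eq_zero.1 ((mul_eq_zero.1 hmul).resolve_left (hdiag i).ne')).symm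
    · rw [← sub_nonneg, mulVec_sub_apply i hprefix]
      exact mul_nonneg (hdiag i).le (sub_nonneg.2 (Pi.apply_le_of_toLex hxy hprefix))
  · simp only [zero_mulVec, le_refl]

end LexOrder

section Contraction

open scoped Matrix.Norms.Operator

variable {d : ℕ}

theorem tendsto_conj_diagonal_pow {G : Matrix (Fin d) (Fin d) ℝ} (hG : G.IsLowerTriangular) :
    Tendsto (fun K : ℝ => diagonal (fun i : Fin d => (K ^ (i : ℕ))⁻¹) * G *
      diagonal fun i : Fin d => K ^ (i : ℕ)) atTop (𝓝 (diagonal G.diag)) := by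
  refine tendsto_pi_nhds.2 fun i => tendsto_pi_nhds.2 fun j => ?_
  simp only [mul_diagonal, diagonal_mul]
  rcases lt_trichotomy j i with hlt | rfl | hgt
  · rw [diagonal_apply_ne' _ hlt.ne]
    have h := (tendsto_pow_div_pow_atTop_zero (𝕜 := ℝ) (Fin.lt_def.1 hlt)).mul_const (G i j)
    rw [zero_mul] at h
    exact h.congr fun K => by ring
  · rw [diagonal_apply_eq]
    refine tendsto_const_nhds.congr' ?_
    filter_upwards [eventually_ne_atTop 0] with K hK
    field_simp
    simp
  · rw [diagonal_apply_ne _ hgt.ne, hG hgt]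
    simp only [mul_zero, zero_mul, tendsto_const_nhds]

theorem exists_conj_norm_le {E : Type*} [Finite E] {G : E → Matrix (Fin d) (Fin d) ℝ}
    (hlower : ∀ e, (G e).IsLowerTriangular) (hdiag : ∀ e i, |G e i i| < 1) :
    ∃ (P Q : Matrix (Fin d) (Fin d) ℝ) (ρ : ℝ), P * Q = 1 ∧ 0 ≤ ρ ∧ ρ < 1 ∧
      ∀ e, ‖Q * G e * P‖ ≤ ρ := by
  have norm_diag_lt : ∀ e, ‖diagonal (G e).diag‖ < 1 := fun e => by
    rw [linfty_opNorm_diagonal, pi_norm_lt_iff one_pos]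
    exact hdiag e
  have conj_norm_lt := eventually_all.2 fun e =>
    (tendsto_conj_diagonal_pow (hlower e)).norm.eventually_lt_const (norm_diag_lt e)
  obtain ⟨K, hlt, hK⟩ := (conj_norm_lt.and (eventually_ne_atTop 0)).exists
  have le_near_one := eventually_all.2 fun e => (eventually_ge_nhds (hlt e)).filter_mono
    (nhdsWithin_le_nhds (s := Set.Iio 1))
  obtain ⟨ρ, hle, hρ0, hρ1⟩ := (le_near_one.and (Ico_mem_nhdsLT one_pos)).exists
  refine ⟨_, _, ρ, ?_, hρ0, hρ1, hle⟩
  simp [diagonal_mul_diagonal, hK]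

end Contraction

section Trajectories

theorem integrable_of_dependsOn {ι F : Type*} {Z : ι → Type*} [∀ i, MeasurableSpace (Z i)]
    [∀ i, Finite (Z i)] [∀ i, MeasurableSingletonClass (Z i)] [NormedAddCommGroup F]
    {μ : Measure (∀ i, Z i)} [IsFiniteMeasure μ] {s : Set ι} [Finite s]
    {f : (∀ i, Z i) → F} (hf : DependsOn f s) : Integrable f μ := by
  obtain ⟨g, rfl⟩ := dependsOn_iff_exists_comp.1 hf
  exact (Integrable.of_finite (f := g)).comp_measurable
    (measurable_pi_lambda _ fun i => measurable_pi_apply (i : ι))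

variable {X : ℕ → Type*} [∀ n, MeasurableSpace (X n)] {μ₀ : Measure (X 0)}
  {κ : (n : ℕ) → Kernel (∀ i : Finset.Iic n, X i) (X (n + 1))} [∀ n, IsMarkovKernel (κ n)]

theorem map_trajMeasure_zero : (Kernel.trajMeasure μ₀ κ).map (fun ω => ω 0) = μ₀ := by
  let initial : (∀ i : Finset.Iic 0, X i) ≃ᵐ X 0 := MeasurableEquiv.piUnique _
  have map_frestrictLe : (Kernel.trajMeasure μ₀ κ).map (Preorder.frestrictLe 0) =
      μ₀.map initial.symm := by
    rw [Kernel.trajMeasure, Measure.map_comp _ _ (by fun_prop), Kernel.traj_map_frestrictLe,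
      Kernel.partialTraj_self]
    exact Measure.id_comp
  calc (Kernel.trajMeasure μ₀ κ).map (fun ω => ω 0)
      = ((Kernel.trajMeasure μ₀ κ).map (Preorder.frestrictLe 0)).map initial :=
        (Measure.map_map initial.measurable (Preorder.measurable_frestrictLe 0)).symm
    _ = μ₀ := by rw [map_frestrictLe, MeasurableEquiv.map_map_symm]

theorem integral_trajMeasure_succ [IsProbabilityMeasure μ₀] [∀ n, Finite (X n)]
    [∀ n, MeasurableSingletonClass (X n)] {F : Type*} [NormedAddCommGroup F] [NormedSpace ℝ F]
    [CompleteSpace F] {n : ℕ} {f : (∀ i, X i) → X (n + 1) → F} (hf : DependsOn f (Set.Iic n)) :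
    ∫ ω, f ω (ω (n + 1)) ∂Kernel.trajMeasure μ₀ κ =
      ∫ ω, ∫ x, f ω x ∂κ n (Preorder.frestrictLe n ω) ∂Kernel.trajMeasure μ₀ κ := by
  rw [← Finset.coe_Iic] at hf
  obtain ⟨g, rfl⟩ := dependsOn_iff_exists_comp.1 hf
  set P := Kernel.trajMeasure μ₀ κ
  have : IsProbabilityMeasure (P.map (Preorder.frestrictLe n)) :=
    Measure.isProbabilityMeasure_map (by fun_prop)
  have map_pair : P.map (fun ω => (Preorder.frestrictLe n ω, ω (n + 1))) =
      P.map (Preorder.frestrictLe n) ⊗ₘ κ n :=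
    Kernel.map_frestrictLe_trajMeasure_compProd_eq_map_trajMeasure.symm
  let onPair : (∀ i : Finset.Iic n, X i) × X (n + 1) → F := fun p => g p.1 p.2
  calc ∫ ω, onPair (Preorder.frestrictLe n ω, ω (n + 1)) ∂P
      = ∫ p, onPair p ∂P.map fun ω => (Preorder.frestrictLe n ω, ω (n + 1)) :=
        (integral_map (by fun_prop) Integrable.of_finite.1).symm
    _ = ∫ h, ∫ x, g h x ∂κ n h ∂P.map (Preorder.frestrictLe n) := by
        rw [map_pair, Measure.integral_compProd Integrable.of_finite]
    _ = ∫ ω, ∫ x, g (Preorder.frestrictLe n ω) x ∂κ n (Preorder.frestrictLe n ω) ∂P :=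
        integral_map (f := fun h => ∫ x, g h x ∂κ n h) (by fun_prop) Integrable.of_finite.1

end Trajectories

theorem integral_toMeasure_bind {α β F : Type*} [Finite α] [MeasurableSpace α]
    [MeasurableSingletonClass α] [Finite β] [MeasurableSpace β] [MeasurableSingletonClass β]
    [NormedAddCommGroup F] [NormedSpace ℝ F] [CompleteSpace F]
    (p : PMF α) (q : α → PMF β) (f : β → F) :
    ∫ x, f x ∂(p.bind q).toMeasure = ∫ a, ∫ x, f x ∂(q a).toMeasure ∂p.toMeasure := by
  have := Fintype.ofFinite α
  have := Fintype.ofFinite β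
  have toReal_bind : ∀ x, (p.bind q x).toReal = ∑ a, (p a).toReal * (q a x).toReal := by
    intro x
    rw [PMF.bind_apply, tsum_fintype, ENNReal.toReal_sum fun a _ =>
      ENNReal.mul_ne_top (PMF.apply_ne_top _ _) (PMF.apply_ne_top _ _)]
    simp only [ENNReal.toReal_mul]
  simp only [PMF.integral_eq_sum, toReal_bind, Finset.sum_smul, Finset.smul_sum, mul_smul]
  exact Finset.sum_comm

namespace LMDP

variable {S A E : Type*} {d : ℕ} (M : LMDP S A E d)

section Events

theorem isLowerTriangular_mult (e : E) : (M.mult e).IsLowerTriangular := by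
  rcases M.mult_mem e with hG | hG
  · exact fun i j hij => hG.1 i j hij
  · rw [Set.mem_singleton_iff.1 hG]
    exact blockTriangular_zero

theorem mult_diag_nonneg (e : E) (i : Fin d) : 0 ≤ M.mult e i i := by
  rcases M.mult_mem e with hG | hG
  · exact (hG.2 i).le
  · rw [Set.mem_singleton_iff.1 hG, Matrix.zero_apply]

variable {M} in
theorem toLex_discount_mulVec_mono (e : ℕ → E) (n : ℕ) {x y : Fin d → ℝ}
    (hxy : toLex x ≤ toLex y) :
    toLex (M.discount e n *ᵥ x) ≤ toLex (M.discount e n *ᵥ y) := by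
  induction n generalizing x y with
  | zero => simpa only [discount, one_mulVec] using hxy
  | succ n ih =>
    simp only [discount, ← mulVec_mulVec]
    exact ih (toLex_mulVec_mono (M.mult_mem _) hxy)

theorem discount_congr {e e' : ℕ → E} {n : ℕ} (h : ∀ t < n, e t = e' t) :
    M.discount e n = M.discount e' n := by
  induction n with
  | zero => rfl
  | succ n ih => rw [discount, discount, ih fun t ht => h t (ht.trans n.lt_succ_self),
      h n n.lt_succ_self]

/-- The `n`-step return of reinforcement learning: the return of the first `n` events, with the
terminal value `v` standing in for the return after them. -/
noncomputable def nStepReturn (e : ℕ → E) (n : ℕ) (v : Fin d → ℝ) : Fin d → ℝ :=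
  ∑ t ∈ Finset.range n, M.discountedReward e t + M.discount e n *ᵥ v

theorem nStepReturn_zero (e : ℕ → E) (v : Fin d → ℝ) : M.nStepReturn e 0 v = v := by
  simp only [nStepReturn, Finset.range_zero, Finset.sum_empty, discount, one_mulVec, zero_add]

theorem nStepReturn_succ (e : ℕ → E) (n : ℕ) (v : Fin d → ℝ) :
    M.nStepReturn e (n + 1) v = M.nStepReturn e n (M.reward (e n) + M.mult (e n) *ᵥ v) := by
  simp only [nStepReturn, Finset.sum_range_succ, discountedReward, discount, mulVec_add,
    mulVec_mulVec, add_assoc]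

theorem nStepReturn_congr {e e' : ℕ → E} {n : ℕ} (h : ∀ t < n, e t = e' t) :
    M.nStepReturn e n = M.nStepReturn e' n := by
  funext v
  rw [nStepReturn, nStepReturn, M.discount_congr h]
  refine congrArg (· + _) (Finset.sum_congr rfl fun t ht => ?_)
  have htn := Finset.mem_range.1 ht
  rw [discountedReward, discountedReward, M.discount_congr fun k hk => h k (hk.trans htn), h t htn]

theorem toLex_nStepReturn_mono (e : ℕ → E) (n : ℕ) {v w : Fin d → ℝ} (hvw : toLex v ≤ toLex w) :
    toLex (M.nStepReturn e n v) ≤ toLex (M.nStepReturn e n w) :=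
  add_le_add_right (toLex_discount_mulVec_mono e n hvw) _

theorem integral_nStepReturn (e : ℕ → E) (n : ℕ) {Ω : Type*} [MeasurableSpace Ω] {μ : Measure Ω}
    [IsProbabilityMeasure μ] {Y : Ω → Fin d → ℝ} (hY : Integrable Y μ) :
    ∫ ω, M.nStepReturn e n (Y ω) ∂μ = M.nStepReturn e n (∫ ω, Y ω ∂μ) := by
  let D : (Fin d → ℝ) →L[ℝ] (Fin d → ℝ) := (M.discount e n).mulVecLin.toContinuousLinearMap
  calc ∫ ω, (∑ t ∈ Finset.range n, M.discountedReward e t + D (Y ω)) ∂μ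
      = ∑ t ∈ Finset.range n, M.discountedReward e t + ∫ ω, D (Y ω) ∂μ := by
        rw [integral_add (integrable_const _) (D.integrable_comp hY), integral_const,
          probReal_univ, one_smul]
    _ = M.nStepReturn e n (∫ ω, Y ω ∂μ) := by
        rw [D.integral_comp_comm hY]
        rfl

variable {M} [Finite E] (hM : M.DiagonalDiscount)
include hM

open scoped Matrix.Norms.Operator in
theorem exists_norm_discount_mulVec_le :
    ∃ C ρ : ℝ, 0 ≤ C ∧ 0 ≤ ρ ∧ ρ < 1 ∧ ∀ e t v, ‖M.discount e t *ᵥ v‖ ≤ C * ‖v‖ * ρ ^ t := by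
  obtain ⟨P, Q, ρ, hPQ, hρ0, hρ1, hρ⟩ := exists_conj_norm_le M.isLowerTriangular_mult fun e i => by
    simpa only [abs_of_nonneg (M.mult_diag_nonneg e i)] using hM e i
  have norm_conj_le : ∀ e t, ‖Q * M.discount e t * P‖ ≤ ‖Q * P‖ * ρ ^ t := by
    intro e t
    induction t with
    | zero => simp only [discount, mul_one, pow_zero, le_refl]
    | succ t ih =>
      calc ‖Q * M.discount e (t + 1) * P‖
          = ‖(Q * M.discount e t * P) * (Q * M.mult (e t) * P)‖ := by
            simp only [discount, mul_assoc]
            rw [← mul_assoc P Q, hPQ, one_mul]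
        _ ≤ ‖Q * P‖ * ρ ^ t * ρ := (norm_mul_le _ _).trans
            (mul_le_mul ih (hρ _) (norm_nonneg _) (by positivity))
        _ = ‖Q * P‖ * ρ ^ (t + 1) := by rw [pow_succ, mul_assoc]
  refine ⟨‖P‖ * ‖Q * P‖ * ‖Q‖, ρ, by positivity, hρ0, hρ1, fun e t v => ?_⟩
  calc ‖M.discount e t *ᵥ v‖
      = ‖P *ᵥ (Q * M.discount e t * P) *ᵥ Q *ᵥ v‖ := by
        simp only [mulVec_mulVec, ← mul_assoc, hPQ, one_mul]
        simp only [mul_assoc, hPQ, mul_one]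
    _ ≤ ‖P‖ * (‖Q * P‖ * ρ ^ t * (‖Q‖ * ‖v‖)) := by
        refine (linfty_opNorm_mulVec _ _).trans ?_
        gcongr
        refine (linfty_opNorm_mulVec _ _).trans ?_
        gcongr
        · exact norm_conj_le e t
        · exact linfty_opNorm_mulVec _ _
    _ = ‖P‖ * ‖Q * P‖ * ‖Q‖ * ‖v‖ * ρ ^ t := by ring

theorem exists_norm_discountedReward_le :
    ∃ C ρ : ℝ, 0 ≤ ρ ∧ ρ < 1 ∧ ∀ e t, ‖M.discountedReward e t‖ ≤ C * ρ ^ t := by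
  obtain ⟨C, ρ, hC, hρ0, hρ1, hdiscount⟩ := exists_norm_discount_mulVec_le hM
  obtain ⟨R, hR⟩ := Finite.exists_le fun e => ‖M.reward e‖
  refine ⟨C * R, ρ, hρ0, hρ1, fun e t => (hdiscount e t _).trans ?_⟩
  gcongr
  exact hR _

theorem summable_discountedReward (e : ℕ → E) : Summable (M.discountedReward e) := by
  obtain ⟨C, ρ, hρ0, hρ1, h⟩ := exists_norm_discountedReward_le hM
  exact Summable.of_norm_bounded ((summable_geometric_of_lt_one hρ0 hρ1).mul_left C) (h e)

theorem tendsto_nStepReturn (e : ℕ → E) {v : ℕ → Fin d → ℝ} {R : ℝ} (hv : ∀ n, ‖v n‖ ≤ R) :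
    Tendsto (fun n => M.nStepReturn e n (v n)) atTop (𝓝 (M.eventReturn e)) := by
  obtain ⟨C, ρ, hC, hρ0, hρ1, hdiscount⟩ := exists_norm_discount_mulVec_le hM
  have remainder : Tendsto (fun n => M.discount e n *ᵥ v n) atTop (𝓝 0) := by
    refine squeeze_zero_norm (a := fun n => C * R * ρ ^ n)
      (fun n => (hdiscount e n _).trans ?_) ?_
    · gcongr
      exact hv n
    · simpa only [mul_zero] using
        (tendsto_pow_atTop_nhds_zero_of_lt_one hρ0 hρ1).const_mul (C * R)
  simpa only [add_zero, nStepReturn, eventReturn] using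
    (summable_discountedReward hM e).hasSum.tendsto_sum_nat.add remainder

theorem exists_norm_nStepReturn_le (R : ℝ) :
    ∃ B : ℝ, ∀ e n v, ‖v‖ ≤ R → ‖M.nStepReturn e n v‖ ≤ B := by
  obtain ⟨C, ρ, hC, hρ0, hρ1, hdiscount⟩ := exists_norm_discount_mulVec_le hM
  obtain ⟨C', σ, hσ0, hσ1, hreward⟩ := exists_norm_discountedReward_le hM
  refine ⟨∑' t, C' * σ ^ t + C * R, fun e n v hv => (norm_add_le _ _).trans (add_le_add ?_ ?_)⟩
  · have hsum := (summable_geometric_of_lt_one hσ0 hσ1).mul_left C'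
    exact (norm_sum_le_of_le _ fun t _ => hreward e t).trans
      (hsum.sum_le_tsum _ fun t _ => (norm_nonneg _).trans (hreward e t))
  · calc ‖M.discount e n *ᵥ v‖ ≤ C * ‖v‖ * ρ ^ n := hdiscount e n v
      _ ≤ C * ‖v‖ := mul_le_of_le_one_right (by positivity) (pow_le_one₀ hρ0 hρ1.le)
      _ ≤ C * R := by gcongr

end Events

section OneStep

/-- The return of a single step followed by the value `V` of the state it reaches: the target of
temporal-difference learning. -/
def stepReturn (V : S → Fin d → ℝ) (x : Step S A E) : Fin d → ℝ :=
  M.reward x.event + M.mult x.event *ᵥ V x.next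

/-- The one-step lookahead: the `Q`-values obtained from `V` by a Bellman backup. -/
noncomputable def lookahead (V : S → Fin d → ℝ) (s : S) (a : A) : Fin d → ℝ :=
  ∫ x, M.stepReturn V x ∂(M.stepLaw s a).toMeasure

theorem policyStep_stationary (f : S → A) (s : S) {n : ℕ} (h : Fin n → Step S A E) :
    M.policyStep (Policy.stationary E f) s h =
      M.stepLaw (currentState s h) (f (currentState s h)) :=
  PMF.pure_bind _ _

variable {M} [Finite S] [Finite A] [Finite E]

theorem toLex_integral_stepReturn_policyStep_le {V : S → Fin d → ℝ}
    (hV : ∀ s a, toLex (M.lookahead V s a) ≤ toLex (V s)) (π : Policy S A E) (s : S) {n : ℕ}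
    (h : Fin n → Step S A E) :
    toLex (∫ x, M.stepReturn V x ∂(M.policyStep π s h).toMeasure) ≤
      toLex (V (currentState s h)) := by
  let _ : MeasurableSpace A := ⊤
  have : DiscreteMeasurableSpace A := ⟨fun _ => trivial⟩
  calc toLex (∫ x, M.stepReturn V x ∂(M.policyStep π s h).toMeasure)
      = toLex (∫ a, M.lookahead V (currentState s h) a ∂(π n s h).toMeasure) :=
        congrArg toLex (integral_toMeasure_bind _ _ _)
    _ ≤ toLex (∫ _, V (currentState s h) ∂(π n s h).toMeasure) :=
        toLex_integral_mono_ae .of_finite .of_finite (ae_of_all _ fun a => hV _ a)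
    _ = toLex (V (currentState s h)) := by rw [integral_const, probReal_univ, one_smul]

end OneStep

section Bootstrapping

variable {M} [Finite S] [Finite A] [Finite E]

instance (π : Policy S A E) (s : S) (μ : PMF (Step S A E)) :
    IsProbabilityMeasure (M.trajLaw π s μ) := by
  unfold trajLaw
  infer_instance

variable (M) in
/-- The value of the first `n + 1` steps, bootstrapped with `V`: the expected return when the
process stops after step `n` and pays out `V` of the state reached. -/
noncomputable def bootstrappedValue (π : Policy S A E) (s : S) (μ : PMF (Step S A E))
    (V : S → Fin d → ℝ) (n : ℕ) : Fin d → ℝ :=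
  ∫ ω, M.nStepReturn (fun t => (ω t).event) (n + 1) (V (ω n).next) ∂M.trajLaw π s μ

variable (π : Policy S A E) (s : S) (μ : PMF (Step S A E)) (V : S → Fin d → ℝ)

theorem integrable_nStepReturn (n : ℕ) (v : (Fin (n + 1) → Step S A E) → Fin d → ℝ) :
    Integrable (fun ω => M.nStepReturn (fun t => (ω t).event) (n + 1)
      (v fun i : Fin (n + 1) => ω i)) (M.trajLaw π s μ) :=
  integrable_of_dependsOn (s := Set.Iic n) fun ω ω' h => by
    have past_eq : ∀ t < n + 1, ω t = ω' t := fun t ht => h t (Nat.lt_succ_iff.1 ht)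
    rw [M.nStepReturn_congr fun t ht => congrArg Step.event (past_eq t ht),
      funext fun i : Fin (n + 1) => past_eq i i.2]

theorem toLex_integral_nStepReturn_mono {n : ℕ} {v w : (Fin (n + 1) → Step S A E) → Fin d → ℝ}
    (hvw : ∀ h, toLex (v h) ≤ toLex (w h)) :
    toLex (∫ ω, M.nStepReturn (fun t => (ω t).event) (n + 1) (v fun i : Fin (n + 1) => ω i)
        ∂M.trajLaw π s μ) ≤
      toLex (∫ ω, M.nStepReturn (fun t => (ω t).event) (n + 1) (w fun i : Fin (n + 1) => ω i)
        ∂M.trajLaw π s μ) :=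
  toLex_integral_mono_ae (integrable_nStepReturn π s μ n v) (integrable_nStepReturn π s μ n w)
    (ae_of_all _ fun _ => M.toLex_nStepReturn_mono _ _ (hvw _))

theorem bootstrappedValue_zero :
    M.bootstrappedValue π s μ V 0 = ∫ x, M.stepReturn V x ∂μ.toMeasure := by
  have map_zero : (M.trajLaw π s μ).map (fun ω => ω 0) = μ.toMeasure := map_trajMeasure_zero
  rw [← map_zero, integral_map (measurable_pi_apply 0).aemeasurable Integrable.of_finite.1]
  simp only [bootstrappedValue, nStepReturn_succ, nStepReturn_zero, stepReturn]

theorem bootstrappedValue_succ (n : ℕ) :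
    M.bootstrappedValue π s μ V (n + 1) =
      ∫ ω, M.nStepReturn (fun t => (ω t).event) (n + 1)
        (∫ x, M.stepReturn V x ∂(M.policyStep π s fun i : Fin (n + 1) => ω i).toMeasure)
        ∂M.trajLaw π s μ := by
  calc M.bootstrappedValue π s μ V (n + 1)
      = ∫ ω, M.nStepReturn (fun t => (ω t).event) (n + 1) (M.stepReturn V (ω (n + 1)))
          ∂M.trajLaw π s μ := by
        simp only [bootstrappedValue, nStepReturn_succ _ _ (n + 1), stepReturn]
    _ = ∫ ω, ∫ x, M.nStepReturn (fun t => (ω t).event) (n + 1) (M.stepReturn V x)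
          ∂(M.policyStep π s fun i : Fin (n + 1) => ω i).toMeasure ∂M.trajLaw π s μ :=
        integral_trajMeasure_succ (X := fun _ => Step S A E)
          (f := fun ω x => M.nStepReturn (fun t => (ω t).event) (n + 1) (M.stepReturn V x))
          fun ω ω' h => funext fun x => congrFun (M.nStepReturn_congr fun t ht =>
            congrArg Step.event (h t (Nat.lt_succ_iff.1 ht))) _
    _ = _ := by simp only [M.integral_nStepReturn _ _ Integrable.of_finite]

variable {π s V}

theorem antitone_toLex_bootstrappedValue
    (hV : ∀ n (h : Fin n → Step S A E),
      toLex (∫ x, M.stepReturn V x ∂(M.policyStep π s h).toMeasure) ≤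
        toLex (V (currentState s h))) :
    Antitone fun n => toLex (M.bootstrappedValue π s μ V n) :=
  antitone_nat_of_succ_le fun n => by
    rw [bootstrappedValue_succ]
    exact toLex_integral_nStepReturn_mono π s μ (hV (n + 1))

theorem monotone_toLex_bootstrappedValue
    (hV : ∀ n (h : Fin n → Step S A E), toLex (V (currentState s h)) ≤
      toLex (∫ x, M.stepReturn V x ∂(M.policyStep π s h).toMeasure)) :
    Monotone fun n => toLex (M.bootstrappedValue π s μ V n) :=
  monotone_nat_of_le_succ fun n => by
    rw [bootstrappedValue_succ]
    exact toLex_integral_nStepReturn_mono π s μ (hV (n + 1))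

variable (hM : M.DiagonalDiscount)
include hM

variable (π s) in
theorem integrable_trajReturn : Integrable M.trajReturn (M.trajLaw π s μ) := by
  obtain ⟨B, hB⟩ := exists_norm_nStepReturn_le hM 0
  have tendsto_trajReturn : ∀ ω : ℕ → Step S A E, Tendsto
      (fun n => M.nStepReturn (fun t => (ω t).event) (n + 1) 0) atTop (𝓝 (M.trajReturn ω)) :=
    fun ω => (tendsto_nStepReturn hM _ fun _ => norm_zero.le).comp (tendsto_add_atTop_nat 1)
  refine Integrable.of_bound (aestronglyMeasurable_of_tendsto_ae atTop
    (fun n => (integrable_nStepReturn π s μ n 0).1) (ae_of_all _ tendsto_trajReturn)) B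
    (ae_of_all _ fun ω => ?_)
  exact le_of_tendsto' (tendsto_trajReturn ω).norm fun n => hB _ _ _ norm_zero.le

variable (π s V) in
theorem tendsto_bootstrappedValue :
    Tendsto (M.bootstrappedValue π s μ V) atTop (𝓝 (∫ ω, M.trajReturn ω ∂M.trajLaw π s μ)) := by
  obtain ⟨R, hR⟩ := Finite.exists_le fun s => ‖V s‖
  obtain ⟨B, hB⟩ := exists_norm_nStepReturn_le hM R
  refine tendsto_integral_of_dominated_convergence (fun _ => B)
    (fun n => (integrable_nStepReturn π s μ n fun h => V (currentState s h)).1)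
    (integrable_const _) (fun n => ae_of_all _ fun ω => hB _ _ _ (hR _)) (ae_of_all _ fun ω => ?_)
  exact (tendsto_nStepReturn hM (fun t => (ω t).event)
    (v := fun n => V (ω (n - 1)).next) fun n => hR _).comp (tendsto_add_atTop_nat 1)

theorem toLex_integral_trajReturn_le
    (hV : ∀ n (h : Fin n → Step S A E),
      toLex (∫ x, M.stepReturn V x ∂(M.policyStep π s h).toMeasure) ≤
        toLex (V (currentState s h))) :
    toLex (∫ ω, M.trajReturn ω ∂M.trajLaw π s μ) ≤ toLex (∫ x, M.stepReturn V x ∂μ.toMeasure) := by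
  rw [← bootstrappedValue_zero π s μ V, ← neg_le_neg_iff, ← toLex_neg, ← toLex_neg]
  exact toLex_le_toLex_of_tendsto (antitone_toLex_bootstrappedValue μ hV).neg
    (tendsto_bootstrappedValue π s μ V hM).neg 0

theorem le_toLex_integral_trajReturn
    (hV : ∀ n (h : Fin n → Step S A E), toLex (V (currentState s h)) ≤
      toLex (∫ x, M.stepReturn V x ∂(M.policyStep π s h).toMeasure)) :
    toLex (∫ x, M.stepReturn V x ∂μ.toMeasure) ≤ toLex (∫ ω, M.trajReturn ω ∂M.trajLaw π s μ) := by
  rw [← bootstrappedValue_zero π s μ V]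
  exact toLex_le_toLex_of_tendsto (monotone_toLex_bootstrappedValue μ hV)
    (tendsto_bootstrappedValue π s μ V hM) 0

end Bootstrapping

section PolicyEvaluation

variable {M} [Finite S] [Finite A] [Finite E] (hM : M.DiagonalDiscount)
include hM

theorem qValue_le {V : S → Fin d → ℝ} (hV : ∀ s a, toLex (M.lookahead V s a) ≤ toLex (V s))
    (π : Policy S A E) (s : S) (a : A) :
    toLex (M.qValue π s a) ≤ toLex (M.lookahead V s a) :=
  toLex_integral_trajReturn_le _ hM fun _ => toLex_integral_stepReturn_policyStep_le hV π s

theorem value_le {V : S → Fin d → ℝ} (hV : ∀ s a, toLex (M.lookahead V s a) ≤ toLex (V s))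
    (π : Policy S A E) (s : S) : toLex (M.value π s) ≤ toLex (V s) :=
  have policyStep_le := fun n => toLex_integral_stepReturn_policyStep_le hV π s (n := n)
  (toLex_integral_trajReturn_le _ hM policyStep_le).trans (policyStep_le 0 Fin.elim0)

theorem le_value_stationary {V : S → Fin d → ℝ} {f : S → A}
    (hV : ∀ s, toLex (V s) ≤ toLex (M.lookahead V s (f s))) (s : S) :
    toLex (V s) ≤ toLex (M.value (Policy.stationary E f) s) := by
  have le_policyStep : ∀ n (h : Fin n → Step S A E), toLex (V (currentState s h)) ≤
      toLex (∫ x, M.stepReturn V x ∂(M.policyStep (Policy.stationary E f) s h).toMeasure) := by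
    intro n h
    rw [policyStep_stationary]
    exact hV _
  exact (le_policyStep 0 Fin.elim0).trans (le_toLex_integral_trajReturn _ hM le_policyStep)

theorem integral_trajReturn_stationary {V : S → Fin d → ℝ} {f : S → A}
    (hV : ∀ s, M.lookahead V s (f s) = V s) (s : S) (μ : PMF (Step S A E)) :
    ∫ ω, M.trajReturn ω ∂M.trajLaw (Policy.stationary E f) s μ =
      ∫ x, M.stepReturn V x ∂μ.toMeasure := by
  have policyStep_eq : ∀ n (h : Fin n → Step S A E),
      ∫ x, M.stepReturn V x ∂(M.policyStep (Policy.stationary E f) s h).toMeasure =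
        V (currentState s h) := by
    intro n h
    rw [policyStep_stationary]
    exact hV _
  exact toLex.injective (le_antisymm
    (toLex_integral_trajReturn_le μ hM fun n h => (congrArg toLex (policyStep_eq n h)).le)
    (le_toLex_integral_trajReturn μ hM fun n h => (congrArg toLex (policyStep_eq n h)).ge))

theorem qValue_stationary_eq {V : S → Fin d → ℝ} {f : S → A}
    (hV : ∀ s, M.lookahead V s (f s) = V s) :
    M.qValue (Policy.stationary E f) = M.lookahead V :=
  funext fun s => funext fun a => integral_trajReturn_stationary hM hV s (M.stepLaw s a)

theorem value_stationary_eq {V : S → Fin d → ℝ} {f : S → A}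
    (hV : ∀ s, M.lookahead V s (f s) = V s) : M.value (Policy.stationary E f) = V := by
  funext s
  rw [value, lawV, integral_trajReturn_stationary hM hV, policyStep_stationary]
  exact hV s

end PolicyEvaluation

section BellmanEquation

/-- `V` solves the lexicographic Bellman optimality equation: `V s` is the greatest one-step
lookahead at `s`. -/
def IsBellmanOptimal (V : S → Fin d → ℝ) : Prop :=
  ∀ s, IsGreatest (Set.range fun a => toLex (M.lookahead V s a)) (toLex (V s))

namespace IsBellmanOptimal

variable {M} {V : S → Fin d → ℝ} (hV : M.IsBellmanOptimal V)
include hV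

theorem toLex_lookahead_le (s : S) (a : A) : toLex (M.lookahead V s a) ≤ toLex (V s) :=
  (hV s).2 ⟨a, rfl⟩

theorem exists_greedy : ∃ f : S → A, ∀ s, f s ∈ lexArgmax (M.lookahead V s) := by
  choose f hf using fun s => (hV s).1
  exact ⟨f, fun s a => (hV.toLex_lookahead_le s a).trans (hf s).ge⟩

theorem lookahead_greedy {f : S → A} {s : S} (hf : f s ∈ lexArgmax (M.lookahead V s)) :
    M.lookahead V s (f s) = V s := by
  obtain ⟨a, ha⟩ := (hV s).1
  exact toLex.injective (le_antisymm (hV.toLex_lookahead_le s _) (ha.ge.trans (hf a)))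

end IsBellmanOptimal

/-- The process with the same transitions and multipliers, in which every reward is zero. The
homogeneous policy evaluation equation of `M` is the evaluation equation of this process, so its
only solution is the value function of a process without rewards. -/
def withoutReward : LMDP S A E d where
  __ := M
  reward := 0

theorem trajReturn_withoutReward (ω : ℕ → Step S A E) : M.withoutReward.trajReturn ω = 0 := by
  simp only [trajReturn, eventReturn, discountedReward, withoutReward, Pi.zero_apply, mulVec_zero,
    tsum_zero]

variable [Finite S] [Finite A] [Finite E]

/-- The expected discounted value of the next state under the stationary policy `f`, as a linear
map: the linear part of the policy evaluation equation. -/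
noncomputable def continuation (f : S → A) : (S → Fin d → ℝ) →ₗ[ℝ] (S → Fin d → ℝ) where
  toFun W s := ∫ x, M.mult x.event *ᵥ W x.next ∂(M.stepLaw s (f s)).toMeasure
  map_add' W W' := by
    funext s
    simp only [Pi.add_apply, mulVec_add]
    exact integral_add .of_finite .of_finite
  map_smul' c W := by
    funext s
    simp only [Pi.smul_apply, mulVec_smul, RingHom.id_apply]
    exact integral_smul _ _

theorem lookahead_eq_reward_add_continuation (V : S → Fin d → ℝ) (f : S → A) (s : S) :
    M.lookahead V s (f s) =
      ∫ x, M.reward x.event ∂(M.stepLaw s (f s)).toMeasure + M.continuation f V s :=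
  integral_add .of_finite .of_finite

variable {M}

theorem eq_zero_of_continuation_eq_self (hM : M.DiagonalDiscount) {f : S → A} {W : S → Fin d → ℝ}
    (hW : M.continuation f W = W) : W = 0 := by
  have lookahead_eq : ∀ s, M.withoutReward.lookahead W s (f s) = W s := fun s => by
    have reward_eq_zero : ∀ x : Step S A E, M.withoutReward.reward x.event = 0 := fun _ => rfl
    simp only [lookahead_eq_reward_add_continuation, reward_eq_zero, integral_zero, zero_add]
    exact congrFun hW s
  have hM₀ : M.withoutReward.DiagonalDiscount := hM
  rw [← value_stationary_eq hM₀ lookahead_eq]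
  funext s
  simp only [value, trajReturn_withoutReward, integral_zero, Pi.zero_apply]

theorem exists_lookahead_eq (hM : M.DiagonalDiscount) (f : S → A) :
    ∃ V : S → Fin d → ℝ, ∀ s, M.lookahead V s (f s) = V s := by
  have injective : Function.Injective
      (LinearMap.id - M.continuation f : (S → Fin d → ℝ) →ₗ[ℝ] (S → Fin d → ℝ)) :=
    (injective_iff_map_eq_zero _).2 fun W hW =>
      eq_zero_of_continuation_eq_self hM (sub_eq_zero.1 hW).symm
  obtain ⟨V, hV⟩ := LinearMap.injective_iff_surjective.1 injective fun s =>
    ∫ x, M.reward x.event ∂(M.stepLaw s (f s)).toMeasure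
  refine ⟨V, fun s => ?_⟩
  rw [lookahead_eq_reward_add_continuation]
  exact (eq_add_of_sub_eq (congrFun hV s)).symm

theorem lookahead_value_stationary (hM : M.DiagonalDiscount) (f : S → A) (s : S) :
    M.lookahead (M.value (Policy.stationary E f)) s (f s) =
      M.value (Policy.stationary E f) s := by
  obtain ⟨V, hV⟩ := exists_lookahead_eq hM f
  rw [value_stationary_eq hM hV]
  exact hV s

theorem exists_isBellmanOptimal [Nonempty A] (hM : M.DiagonalDiscount) :
    ∃ V, M.IsBellmanOptimal V := by
  obtain ⟨f, -, hf⟩ := Set.finite_univ.exists_maximalFor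
    (fun (f : S → A) s => toLex (M.value (Policy.stationary E f) s)) Set.univ Set.univ_nonempty
  set V := M.value (Policy.stationary E f)
  choose g hg using fun s => Finite.exists_max fun a => toLex (M.lookahead V s a)
  have improves : ∀ s, toLex (V s) ≤ toLex (M.value (Policy.stationary E g) s) :=
    le_value_stationary hM fun s =>
      (congrArg toLex (lookahead_value_stationary hM f s)).ge.trans (hg s (f s))
  have value_eq : M.value (Policy.stationary E g) = V := funext fun s =>
    toLex.injective (le_antisymm (hf (Set.mem_univ g) improves s) (improves s))
  have lookahead_eq : ∀ s, M.lookahead V s (g s) = V s := fun s => by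
    simpa only [value_eq] using lookahead_value_stationary hM g s
  refine ⟨V, fun s => ⟨⟨g s, congrArg toLex (lookahead_eq s)⟩, ?_⟩⟩
  rintro _ ⟨a, rfl⟩
  exact (hg s a).trans_eq (congrArg toLex (lookahead_eq s))

namespace IsBellmanOptimal

variable {V : S → Fin d → ℝ} (hV : M.IsBellmanOptimal V) (hM : M.DiagonalDiscount)
include hV hM

theorem isUniformlyOptimal_greedy {f : S → A} (hf : ∀ s, f s ∈ lexArgmax (M.lookahead V s)) :
    M.IsUniformlyOptimal (Policy.stationary E f) := by
  refine fun s a => ⟨⟨_, rfl⟩, ?_⟩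
  rintro _ ⟨π, rfl⟩
  rw [qValue_stationary_eq hM fun s => hV.lookahead_greedy (hf s)]
  exact qValue_le hM hV.toLex_lookahead_le π s a

theorem isOptimalFromEveryState_greedy {f : S → A}
    (hf : ∀ s, f s ∈ lexArgmax (M.lookahead V s)) :
    M.IsOptimalFromEveryState (Policy.stationary E f) := by
  intro π s
  rw [value_stationary_eq hM fun s => hV.lookahead_greedy (hf s)]
  exact value_le hM hV.toLex_lookahead_le π s

theorem isOptimalQ_lookahead : M.IsOptimalQ (M.lookahead V) := by
  obtain ⟨f, hf⟩ := hV.exists_greedy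
  rw [← qValue_stationary_eq hM fun s => hV.lookahead_greedy (hf s)]
  exact hV.isUniformlyOptimal_greedy hM hf

end IsBellmanOptimal

end BellmanEquation

end LMDP

theorem mainTheorem6 {S A E : Type*} [Finite S] [Finite A] [Nonempty A] [Finite E] {d : ℕ}
    (M : LMDP S A E d) (hM : M.DiagonalDiscount) :
    -- returns and expected returns are well defined
    ((∀ e : ℕ → E, Summable (M.discountedReward e)) ∧
      ∀ π : Policy S A E, (∀ s a, Integrable M.trajReturn (M.lawQ π s a)) ∧
        ∀ s, Integrable M.trajReturn (M.lawV π s)) ∧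
    -- the optimal `Q`-value function exists; there is a stationary deterministic uniformly
    -- optimal policy; every lexicographically greedy one is such
    ∃ Qstar : S → A → Fin d → ℝ, M.IsOptimalQ Qstar ∧
      (∃ f : S → A, M.IsUniformlyOptimal (Policy.stationary E f) ∧
        M.IsOptimalFromEveryState (Policy.stationary E f)) ∧
      ∀ f : S → A, (∀ s, f s ∈ lexArgmax (Qstar s)) →
        M.IsUniformlyOptimal (Policy.stationary E f) ∧
        M.IsOptimalFromEveryState (Policy.stationary E f) := by
  obtain ⟨V, hV⟩ := LMDP.exists_isBellmanOptimal hM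
  have optimal_of_greedy : ∀ f : S → A, (∀ s, f s ∈ lexArgmax (M.lookahead V s)) →
      M.IsUniformlyOptimal (Policy.stationary E f) ∧
        M.IsOptimalFromEveryState (Policy.stationary E f) := fun f hf =>
    ⟨hV.isUniformlyOptimal_greedy hM hf, hV.isOptimalFromEveryState_greedy hM hf⟩
  obtain ⟨f, hf⟩ := hV.exists_greedy
  exact ⟨⟨LMDP.summable_discountedReward hM, fun π =>
      ⟨fun s a => LMDP.integrable_trajReturn π s _ hM, fun s =>
        LMDP.integrable_trajReturn π s _ hM⟩⟩,
    M.lookahead V, hV.isOptimalQ_lookahead hM, ⟨f, optimal_of_greedy f hf⟩, optimal_of_greedy⟩
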